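/- Let $X$ be a finite alphabet, let $\varepsilon$ be the empty word, and let $\#$ be a symbol not in $X$. For a binary relation $\rho \subseteq X^*\times X^*$ put $L_\rho=\{u\# v^{\mathrm{rev}} : (u,v)\in\rho\}$, a language over $X\cup\{\#\}$. Let $\pi$ be the map sending a word $(x_1,y_1)\cdots(x_k,y_k)$ over the alphabet $X_\varepsilon^2=(X\cup\{\varepsilon\})\times(X\cup\{\varepsilon\})$ to the pair $(x_1\cdots x_k,\;y_1\cdots y_k)\in X^*\times X^*$. For a class $\mathfrak C$ of languages let $U(\mathfrak C)$ be the class of relations $\rho$ with $L_\rho\in\mathfrak C$, and let $T(\mathfrak C)$ be the class of relations $\rho$ such that $\rho=L\pi$ for some language $L$ over $X_\varepsilon^2$ with $L\in\mathfrak C$. Let $\mathcal{CF}$, $\mathcal{ET}0\mathcal{L}$ and $\mathcal{LIN}$ be the classes of context-free languages, of ET0L languages, and of linear indexed languages, respectively, where linear indexed grammars are those in which each production copies the flags of its left-hand side to only one of the (possibly multiple) nonterminals on its right-hand side. **Proposition.** The cyclic permutation relation $$\kappa=\{(uv,vu) : u,v\in X^*\}$$ is in $U(\mathcal{ET}0\mathcal{L})$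 and in $U(\mathcal{LIN})$. If $|X|\ge 2$, then $\kappa$ is not in $T(\mathcal{CF})$. -/

import Mathlib

namespace RelHierarchy

universe u

/-! ### Classes of languages and the two classes of binary relations they determine -/

/-- A class of languages: for every alphabet, a set of languages over that alphabet. -/
abbrev LanguageClass : Type (u + 1) := (α : Type u) → Set (Language α)

/-- The map `π` sending a word `(x₁,y₁)⋯(x_k,y_k)` over `(X ∪ {ε}) × (X ∪ {ε})` to the pair
`(x₁⋯x_k, y₁⋯y_k)`. The type `Option X` is `X ∪ {ε}`, with `none` in the role of `ε`. -/
def tapeProj {X : Type u} (w : List (Option X × Option X)) : List X × List X :=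
  (w.filterMap Prod.fst, w.filterMap Prod.snd)

/-- The unfolded language `L_ρ = {u # v^rev : (u, v) ∈ ρ}` of a relation `ρ` on `X*`.
The type `Option X` is here the alphabet `X ∪ {#}`, with `none` in the role of the new
symbol `#`. -/
def unfolded {X : Type u} (ρ : Set (List X × List X)) : Language (Option X) :=
  {w | ∃ u v : List X, (u, v) ∈ ρ ∧ w = u.map some ++ [none] ++ v.reverse.map some}

/-- The class `T(C)` of two-tape relations, on the words over `X`. -/
def T (C : LanguageClass.{u}) (X : Type u) : Set (Set (List X × List X)) :=
  {ρ | ∃ L ∈ C (Option X × Option X), ρ = tapeProj '' (L : Set (List (Option X × Option X)))}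

/-- The class `U(C)` of unfolded relations, on the words over `X`. -/
def U (C : LanguageClass.{u}) (X : Type u) : Set (Set (List X × List X)) :=
  {ρ | unfolded ρ ∈ C (Option X)}

/-! ### Context-free languages -/

/-- The class of context-free languages. -/
def CF : LanguageClass.{u} := fun _ => {L | L.IsContextFree}

/-! ### ET0L languages -/

/-- An ET0L-system over the terminal alphabet `S`. Its full alphabet consists of the terminals and
of finitely many nonterminals. A table is a finite set of context-free productions that contains
at least one production for every symbol of the full alphabet. -/
structure ET0LSystem (S : Type u) where
  /-- The nonterminal symbols. -/
  NT : Type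
  /-- The set of tables. -/
  tables : Set (Set (Symbol S NT × List (Symbol S NT)))
  /-- The word from which all derivations start. -/
  start : List (Symbol S NT)
  finite_NT : Finite NT
  tables_finite : tables.Finite
  tables_nonempty : tables.Nonempty
  table_finite : ∀ τ ∈ tables, τ.Finite
  table_complete : ∀ τ ∈ tables, ∀ s, ∃ w, (s, w) ∈ τ
  start_ne_nil : start ≠ []

namespace ET0LSystem

variable {S : Type u}

/-- `G.Step a b`: some table of `G` rewrites `a` to `b`, where all the symbols of `a` are
rewritten simultaneously, each by some production of that one table. -/
def Step (G : ET0LSystem S) (a b : List (Symbol S G.NT)) : Prop :=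
  ∃ τ ∈ G.tables, ∃ ws : List (List (Symbol S G.NT)),
    List.Forall₂ (fun s w => (s, w) ∈ τ) a ws ∧ b = ws.flatten

/-- The terminal words derivable from the start word. -/
def language (G : ET0LSystem S) : Language S :=
  {w | Relation.ReflTransGen G.Step G.start (w.map Symbol.terminal)}

end ET0LSystem

/-- The class of ET0L languages. -/
def ET0L : LanguageClass.{u} := fun α => {L | ∃ G : ET0LSystem α, G.language = L}

/-! ### Linear indexed languages -/

/-- Productions of a linear indexed grammar with terminals `S`, nonterminals `N` and flags `F`.
A nonterminal carries a stack of flags, a list whose head is the top of the stack. -/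
inductive LIRule (S : Type u) (N F : Type) where
  /-- `A[pop ··] → left B[push ··] right`: the flags `pop` are removed from the top of the stack of
  `A`, and the rest of the stack is copied to `B` only, below the flags `push`. The nonterminals
  in `left` and `right` get the fixed stacks that are written there. -/
  | pass (A : N) (pop : List F) (left : List (Symbol S (N × List F)))
      (B : N) (push : List F) (right : List (Symbol S (N × List F)))
  /-- `A[stack] → w`, where `w` is a terminal word; it applies to `A` with exactly this stack. -/
  | term (A : N) (stack : List F) (w : List S)

/-- `r.Expands A σ γ`: the production `r` can replace the nonterminal `A` with stack `σ` by `γ`. -/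
inductive LIRule.Expands {S : Type u} {N F : Type} :
    LIRule S N F → N → List F → List (Symbol S (N × List F)) → Prop
  | pass (A : N) (pop : List F) (left : List (Symbol S (N × List F)))
      (B : N) (push : List F) (right : List (Symbol S (N × List F))) (rest : List F) :
      Expands (.pass A pop left B push right) A (pop ++ rest)
        (left ++ [Symbol.nonterminal (B, push ++ rest)] ++ right)
  | term (A : N) (stack : List F) (w : List S) :
      Expands (.term A stack w) A stack (w.map Symbol.terminal)

/-- A linear indexed grammar over the terminal alphabet `S`: in each production the stack of the
left-hand side is copied to only one of the (possibly many) nonterminals on the right. -/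
structure LinearIndexedGrammar (S : Type u) where
  /-- The nonterminal symbols. -/
  NT : Type
  /-- The flags. -/
  Flag : Type
  /-- The start symbol. -/
  initial : NT
  /-- The productions. -/
  rules : Set (LIRule S NT Flag)
  finite_NT : Finite NT
  finite_Flag : Finite Flag
  rules_finite : rules.Finite

namespace LinearIndexedGrammar

variable {S : Type u}

/-- One derivation step: one occurrence of a nonterminal is replaced by means of a production. -/
def Step (G : LinearIndexedGrammar S) (a b : List (Symbol S (G.NT × List G.Flag))) : Prop :=
  ∃ r ∈ G.rules, ∃ A σ γ p q, r.Expands A σ γ ∧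
    a = p ++ [Symbol.nonterminal (A, σ)] ++ q ∧ b = p ++ γ ++ q

/-- The terminal words derivable from the start symbol with the empty stack. -/
def language (G : LinearIndexedGrammar S) : Language S :=
  {w | Relation.ReflTransGen G.Step [Symbol.nonterminal (G.initial, [])] (w.map Symbol.terminal)}

end LinearIndexedGrammar

/-- The class of linear indexed languages. -/
def LIN : LanguageClass.{u} := fun α => {L | ∃ G : LinearIndexedGrammar α, G.language = L}

/-! ### The cyclic permutation relation -/

/-- The relation `κ = {(uv, vu) : u, v ∈ X*}`. -/
def cyclicRel (X : Type u) : Set (List X × List X) :=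
  {p | ∃ u v : List X, p = (u ++ v, v ++ u)}

end RelHierarchy

/-! Membership in `U` is witnessed by explicit systems for the words `u v # u^rev v^rev`. In the
ET0L-system, one table extends both copies of `u`, another both copies of `v`, and a last one erases
all nonterminals. In the linear indexed grammar, `u` is stored on the stack while it is written, `v`
is generated around the centre, and popping the stack writes `u^rev`.

For the negative part, let `u` consist of long blocks of `a^ω` and `b^ω`, and `v` of long blocks of
`(ab)^ω` and `(aabb)^ω`. Letters are tagged by their block. Windows of length three recover the tags
up to boundedly many defects, and cyclic shifts change window counts by at most 2. So two tapes with
few defects that are related by `κ` carry nearly equally many letters of each tag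
(`count_le_of_cyclicRel`). Suppose `z` in a context-free language projects to `(uv, vu)`. Reading
`z`, either `u` on tape 1 is completed before `u` on tape 2 starts, or `v` on tape 2 is completed
before `v` on tape 1 starts. For the two tags `i`, `j` of that word, a short factor of `z` never
meets the same tag on both tapes (`exists_sequential_tags`). Pumping down inside a short factor,
with only the letters tagged `i` or `j` weighed (`exists_pumps`), therefore removes many letters of
some tag from one tape alone, which destroys the balance. -/

namespace RelHierarchy

/-! ### A pumping lemma for context-free languages with weighted letters -/

section Pumping

variable {T : Type*} {Y : Type*} {g : ContextFreeGrammar T} {f : Y → T}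

/-- `Gen g f α w`: the sentential form `α` derives the word `w.map f`, where the letters of `w`
carry annotations that are forgotten by `f`. -/
inductive Gen (g : ContextFreeGrammar T) (f : Y → T) : List (Symbol T g.NT) → List Y → Prop
  | nil : Gen g f [] []
  | terminal (y : Y) {α : List (Symbol T g.NT)} {w : List Y} (h : Gen g f α w) :
      Gen g f (Symbol.terminal (f y) :: α) (y :: w)
  | nonterminal (r : ContextFreeRule T g.NT) (hr : r ∈ g.rules) {α : List (Symbol T g.NT)}
      {v w : List Y} (hv : Gen g f r.output v) (hw : Gen g f α w) :
      Gen g f (Symbol.nonterminal r.input :: α) (v ++ w)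

theorem Gen.map_terminal (w : List Y) :
    Gen g f ((w.map f).map Symbol.terminal) w := by
  induction w with
  | nil => exact .nil
  | cons y w ih => exact .terminal y ih

theorem Gen.append {α β : List (Symbol T g.NT)} {v w : List Y} (hv : Gen g f α v)
    (hw : Gen g f β w) : Gen g f (α ++ β) (v ++ w) := by
  induction hv with
  | nil => exact hw
  | terminal y _ ih => exact .terminal y ih
  | nonterminal r hr hv _ _ ih =>
    rw [List.append_assoc]
    exact .nonterminal r hr hv ih

theorem Gen.exists_of_append {α β : List (Symbol T g.NT)} {w : List Y}
    (h : Gen g f (α ++ β) w) : ∃ u v, w = u ++ v ∧ Gen g f α u ∧ Gen g f β v := by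
  induction α generalizing w with
  | nil => exact ⟨[], w, rfl, .nil, h⟩
  | cons s α ih =>
    cases h with
    | terminal y h =>
      obtain ⟨u, v, rfl, hu, hv⟩ := ih h
      exact ⟨y :: u, v, rfl, .terminal y hu, hv⟩
    | nonterminal r hr h₁ h₂ =>
      obtain ⟨u, v, rfl, hu, hv⟩ := ih h₂
      exact ⟨_ ++ u, v, by simp, .nonterminal r hr h₁ hu, hv⟩

theorem Gen.of_produces {α β : List (Symbol T g.NT)} {w : List Y} (h : g.Produces α β)
    (hw : Gen g f β w) : Gen g f α w := by
  obtain ⟨r, hr, h⟩ := h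
  obtain ⟨p, q, rfl, rfl⟩ := h.exists_parts
  obtain ⟨u, v, rfl, hu, hv⟩ := hw.exists_of_append
  obtain ⟨u₁, u₂, rfl, hu₁, hu₂⟩ := hu.exists_of_append
  have h₂ : Gen g f [Symbol.nonterminal r.input] u₂ := by
    simpa using Gen.nonterminal r hr hu₂ .nil
  exact (hu₁.append h₂).append hv

theorem Gen.of_derives {α : List (Symbol T g.NT)} {w : List Y}
    (h : g.Derives α ((w.map f).map Symbol.terminal)) : Gen g f α w := by
  induction h using Relation.ReflTransGen.head_induction_on with
  | refl => exact .map_terminal w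
  | head h _ ih => exact .of_produces h ih

theorem Gen.derives {α : List (Symbol T g.NT)} {w : List Y} (h : Gen g f α w) :
    g.Derives α ((w.map f).map Symbol.terminal) := by
  induction h with
  | nil => exact .refl _
  | terminal y _ ih => exact ih.append_left [_]
  | @nonterminal r hr α v w _ _ ihv ihw =>
    have h₁ : g.Produces (Symbol.nonterminal r.input :: α) (r.output ++ α) :=
      ⟨r, hr, .head α⟩
    refine h₁.trans_derives ((ihv.append_right α).trans ?_)
    simpa using ihw.append_left _

/-- The total weight of a word. -/
abbrev weight (m : Y → ℕ) (w : List Y) : ℕ := (w.map m).sum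

/-- `IsFactor g f α w B t r q`: the word `w = r t q` is derived from `α` in such a way that `t` is
derived from an occurrence of the nonterminal `B`. -/
structure IsFactor (g : ContextFreeGrammar T) (f : Y → T) (α : List (Symbol T g.NT)) (w : List Y)
    (B : g.NT) (t r q : List Y) : Prop where
  eq : w = r ++ t ++ q
  gen : Gen g f [Symbol.nonterminal B] t
  context : ∀ t', Gen g f [Symbol.nonterminal B] t' → Gen g f α (r ++ t' ++ q)

theorem IsFactor.trans {α : List (Symbol T g.NT)} {w t r q t' r' q' : List Y} {B C : g.NT}
    (h : IsFactor g f α w B t r q)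
    (h' : IsFactor g f [Symbol.nonterminal B] t C t' r' q') :
    IsFactor g f α w C t' (r ++ r') (q' ++ q) where
  eq := by rw [h.eq, h'.eq]; simp
  gen := h'.gen
  context s hs := by simpa using h.context _ (h'.context s hs)

/-- Descend in the derivation tree into a part that is too heavy for its number of symbols, until a
single nonterminal with yield in the range `(H, H * b]` is reached. A terminal weighs at most `H`,
so it never accounts for the excess. -/
theorem Gen.exists_factor {m : Y → ℕ} {H b : ℕ} (hm : ∀ y, m y ≤ H)
    (hb : ∀ r ∈ g.rules, r.output.length ≤ b) {α : List (Symbol T g.NT)} {w : List Y}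
    (h : Gen g f α w) (hw : H * α.length < weight m w) :
    ∃ B t r q, IsFactor g f α w B t r q ∧ (∃ r ∈ g.rules, r.input = B) ∧
      H < weight m t ∧ weight m t ≤ H * b := by
  induction h with
  | nil => simp [weight] at hw
  | @terminal y α w h ih =>
    have hy := hm y
    obtain ⟨B, t, r, q, hf, hB, hl, hu⟩ := ih (by
      simp only [weight, List.length_cons, List.map_cons, List.sum_cons, mul_add, mul_one] at hw ⊢
      omega)
    refine ⟨B, t, y :: r, q, ⟨?_, hf.gen, fun t' ht' => ?_⟩, hB, hl, hu⟩
    · simp [hf.eq]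
    · exact .terminal y (hf.context t' ht')
  | @nonterminal ρ hρ α v w hv hw' ihv ihw =>
    simp only [weight, List.length_cons, List.map_append, List.sum_append, mul_add, mul_one]
      at hw ihv ihw
    by_cases h₂ : H * α.length < (w.map m).sum
    · obtain ⟨B, t, r, q, hf, hB, hl, hu⟩ := ihw h₂
      refine ⟨B, t, v ++ r, q, ⟨?_, hf.gen, fun t' ht' => ?_⟩, hB, hl, hu⟩
      · simp [hf.eq]
      · simpa using Gen.nonterminal ρ hρ hv (hf.context t' ht')
    by_cases h₁ : (v.map m).sum ≤ H * b
    · refine ⟨ρ.input, v, [], w, ⟨by simp, ?_, fun t' ht' => ?_⟩, ⟨ρ, hρ, rfl⟩, ?_, h₁⟩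
      · simpa using Gen.nonterminal ρ hρ hv .nil
      · exact ht'.append hw'
      · simp only [weight]
        omega
    -- Here `v` outweighs `H * b`, hence also `H` times the length of the production's right-hand
    -- side, so the descent continues inside `v`.
    · have hlen := Nat.mul_le_mul_left H (hb ρ hρ)
      obtain ⟨B, t, r, q, hf, hB, hl, hu⟩ := ihv (by omega)
      refine ⟨B, t, r, q ++ w, ⟨?_, hf.gen, fun t' ht' => ?_⟩, hB, hl, hu⟩
      · simp [hf.eq]
      · simpa using Gen.nonterminal ρ hρ (hf.context t' ht') hw'

/-- The weight bounds on nested factors in the pumping lemma. -/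
def pumpBound (b c D : ℕ) : ℕ → ℕ
  | 0 => c
  | k + 1 => pumpBound b c D k * b + D + pumpBound b c D k

theorem le_pumpBound (b c D k : ℕ) : c ≤ pumpBound b c D k := by
  induction k with
  | zero => exact le_rfl
  | succ k ih => simp only [pumpBound]; omega

theorem pumpBound_mono (b c D : ℕ) : Monotone (pumpBound b c D) :=
  monotone_nat_of_le_succ fun k => by simp only [pumpBound]; omega

/-- `w` has a factorization `r s t s' q` such that `α` derives `r t q`, and such that `s` and `s'`
together have weight at least `D`, and `s t s'` has weight at most `p`. -/
def Pumps (g : ContextFreeGrammar T) (f : Y → T) (m : Y → ℕ) (D p : ℕ)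
    (α : List (Symbol T g.NT)) (w : List Y) : Prop :=
  ∃ r s t s' q, w = r ++ (s ++ t ++ s') ++ q ∧ Gen g f α (r ++ t ++ q) ∧
    D ≤ weight m s + weight m s' ∧ weight m (s ++ t ++ s') ≤ p

/-- Letters may have weight zero, so a repeated nonterminal on a path need not give a pump of
positive weight. The bounds `pumpBound` grow so fast that nested factors at successive levels differ
in weight by at least `D`; a repetition then yields a heavy pump, and without one each level
contributes a new nonterminal. -/
theorem Gen.pumps_or_exists_finset {m : Y → ℕ} {b c D : ℕ} (hm : ∀ y, m y ≤ c)
    (hb : ∀ r ∈ g.rules, r.output.length ≤ b) (k : ℕ) {α : List (Symbol T g.NT)} {w : List Y}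
    (h : Gen g f α w) (hw : pumpBound b c D k * α.length < weight m w) :
    Pumps g f m D (pumpBound b c D k * b) α w ∨
      ∃ V : Finset g.NT, V.card = k + 1 ∧ ∀ B ∈ V, (∃ r ∈ g.rules, r.input = B) ∧
        ∃ t r q, IsFactor g f α w B t r q ∧ weight m t ≤ pumpBound b c D k * b := by
  classical
  induction k generalizing α w with
  | zero =>
    obtain ⟨B, t, r, q, hf, hB, -, hu⟩ := h.exists_factor hm hb hw
    refine .inr ⟨{B}, by simp, fun C hC => ?_⟩
    obtain rfl := Finset.mem_singleton.1 hC
    exact ⟨hB, t, r, q, hf, hu⟩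
  | succ k ih =>
    have hmono : pumpBound b c D k * b ≤ pumpBound b c D (k + 1) * b :=
      Nat.mul_le_mul_right b (pumpBound_mono b c D k.le_succ)
    obtain ⟨B, t, r, q, hf, hB, hl, hu⟩ :=
      h.exists_factor (fun y => (hm y).trans (le_pumpBound b c D (k + 1))) hb hw
    have hl' : pumpBound b c D k * b + D + pumpBound b c D k < weight m t := hl
    rcases ih hf.gen (by simp only [List.length_singleton]; omega) with hP | ⟨V, hV, hVB⟩
    · left
      obtain ⟨r', s, t', s', q', rfl, hgen, hD, hp⟩ := hP
      refine ⟨r ++ r', s, t', s', q' ++ q, by simp [hf.eq], ?_, hD, hp.trans hmono⟩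
      simpa using hf.context _ hgen
    -- If `B` recurs inside its own factor `t`, replacing `t` by the inner factor removes weight at
    -- least `D`, by `hl'`.
    by_cases hBV : B ∈ V
    · left
      obtain ⟨-, t', r', q', hf', hu'⟩ := hVB B hBV
      have := hf'.eq
      subst this
      refine ⟨r, r', t', q', q, hf.eq, hf.context _ hf'.gen, ?_, hu⟩
      simp only [weight, List.map_append, List.sum_append] at hl' hu' ⊢
      omega
    · right
      refine ⟨insert B V, by rw [Finset.card_insert_of_notMem hBV, hV], fun C hC => ?_⟩
      rcases Finset.mem_insert.1 hC with rfl | hC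
      · exact ⟨hB, t, r, q, hf, hu⟩
      · obtain ⟨hC, t', r', q', hf', hu'⟩ := hVB C hC
        exact ⟨hC, t', r ++ r', q' ++ q, hf.trans hf', hu'.trans hmono⟩

/-- The bound `p` is chosen before `m`: in the application, the length of the blocks depends on `p`,
and which tags are weighed depends on the word. -/
theorem exists_pumps (g : ContextFreeGrammar T) (c D : ℕ) :
    ∃ p, ∀ (f : Y → T) (m : Y → ℕ), (∀ y, m y ≤ c) → ∀ w : List Y, w.map f ∈ g.language →
      p < weight m w → Pumps g f m D p [Symbol.nonterminal g.initial] w := by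
  classical
  set b := g.rules.sup fun r => r.output.length
  set k := (g.rules.image ContextFreeRule.input).card
  refine ⟨pumpBound b c D k * (b + 1), fun f m hm w hw hlt => ?_⟩
  have hb : ∀ r ∈ g.rules, r.output.length ≤ b := fun r hr =>
    Finset.le_sup (f := fun r : ContextFreeRule T g.NT => r.output.length) hr
  rw [mul_add, mul_one] at hlt ⊢
  rcases (Gen.of_derives hw).pumps_or_exists_finset (D := D) hm hb k
    (by simp only [List.length_singleton]; omega) with ⟨r, s, t, s', q, hP⟩ | ⟨V, hV, hVB⟩
  · exact ⟨r, s, t, s', q, hP.1, hP.2.1, hP.2.2.1, hP.2.2.2.trans (by omega)⟩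
  -- Only `k` nonterminals are left-hand sides, so `k + 1` distinct ones are impossible.
  · have hsub : V ⊆ g.rules.image ContextFreeRule.input := fun B hB => by
      obtain ⟨r, hr, hrB⟩ := (hVB B hB).1
      exact Finset.mem_image.2 ⟨r, hr, hrB⟩
    have := Finset.card_le_card hsub
    omega

end Pumping
/-! ### Statistics of windows of length three -/

section Windows

variable {X : Type*}

open Classical in
/-- The class of the first window of length three of a word. If `b ≠ a`, then the windows of
`a^ω`, `b^ω`, `(ab)^ω`, `(aabb)^ω` have the classes `0`, `1`, `2`, `3`, respectively. -/
noncomputable def windowClass (a : X) : List X → Option (Fin 4)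
  | x :: y :: z :: _ => some (if x = z then if x = y then if x = a then 0 else 1 else 2 else 3)
  | _ => none

theorem windowClass_append {a : X} {j : Fin 4} {l : List X} (h : windowClass a l = some j)
    (l' : List X) : windowClass a (l ++ l') = some j := by
  match l, h with
  | x :: y :: z :: l, h => exact h

/-- The number of windows of class `j`. -/
noncomputable def windowCount (a : X) (j : Fin 4) : List X → ℕ
  | [] => 0
  | x :: l => (if windowClass a (x :: l) = some j then 1 else 0) + windowCount a j l

/-- The number of positions of a word with tagged letters at which the tag differs from the class
of the window starting there. -/
noncomputable def defects (a : X) : List (X × Fin 4) → ℕ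
  | [] => 0
  | y :: l => (if windowClass a ((y :: l).map Prod.fst) = some y.2 then 0 else 1) + defects a l

/-- Only the windows starting at the last two positions of `p` reach across the cut. -/
theorem windowCount_append_le (a : X) (j : Fin 4) (p q : List X) :
    windowCount a j (p ++ q) ≤ windowCount a j p + windowCount a j q + 2 := by
  match p with
  | [] => simp [windowCount]
  | [x] =>
    simp only [List.cons_append, List.nil_append, windowCount]
    split_ifs <;> omega
  | [x, y] =>
    simp only [List.cons_append, List.nil_append, windowCount]
    split_ifs <;> omega
  | x :: y :: z :: p =>
    have ih := windowCount_append_le a j (y :: z :: p) q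
    have h : windowClass a (x :: y :: z :: p ++ q) = windowClass a (x :: y :: z :: p) := rfl
    rw [List.cons_append, windowCount, windowCount, ← List.cons_append, h]
    omega

theorem le_windowCount_append (a : X) (j : Fin 4) (p q : List X) :
    windowCount a j p + windowCount a j q ≤ windowCount a j (p ++ q) := by
  induction p with
  | nil => simp [windowCount]
  | cons x p ih =>
    simp only [List.cons_append, windowCount]
    have h := fun h => windowClass_append (a := a) (j := j) (l := x :: p) h q
    rw [List.cons_append] at h
    split_ifs with h₁ h₂ h₂
    · omega
    · exact absurd (h h₁) h₂
    · omega
    · omega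

theorem windowCount_append_comm_le (a : X) (j : Fin 4) (p q : List X) :
    windowCount a j (p ++ q) ≤ windowCount a j (q ++ p) + 2 := by
  have := windowCount_append_le a j p q
  have := le_windowCount_append a j q p
  omega

/-- Appending can only repair defects: a complete window keeps its class, and a position whose
window is cut off by the end of the word already counts as a defect. -/
theorem defects_append_le (a : X) (p q : List (X × Fin 4)) :
    defects a (p ++ q) ≤ defects a p + defects a q := by
  induction p with
  | nil => simp [defects]
  | cons x p ih =>
    simp only [List.cons_append, defects]
    have h := fun h => windowClass_append (a := a) (j := x.2) (l := (x :: p).map Prod.fst) h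
      (q.map Prod.fst)
    rw [← List.map_append, List.cons_append] at h
    split_ifs with h₁ h₂ h₂
    · omega
    · omega
    · exact absurd (h h₂) h₁
    · omega

theorem le_defects_append (a : X) (p q : List (X × Fin 4)) :
    defects a p + defects a q ≤ defects a (p ++ q) + 2 := by
  match p with
  | [] => simp [defects]
  | [x] =>
    simp only [List.cons_append, List.nil_append, defects]
    split_ifs <;> omega
  | [x, y] =>
    simp only [List.cons_append, List.nil_append, defects]
    split_ifs <;> omega
  | x :: y :: z :: p =>
    have ih := le_defects_append a (y :: z :: p) q
    have h : windowClass a ((x :: y :: z :: p ++ q).map Prod.fst) =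
      windowClass a ((x :: y :: z :: p).map Prod.fst) := rfl
    rw [List.cons_append, defects.eq_def a (x :: y :: z :: p), defects.eq_def a (x :: _)]
    simp only [← List.cons_append, h]
    omega

/-- A position whose window has class `j` either has tag `j` or is a defect. -/
theorem windowCount_le_count_add (a : X) (j : Fin 4) (w : List (X × Fin 4)) :
    windowCount a j (w.map Prod.fst) ≤ (w.map Prod.snd).count j + defects a w := by
  induction w with
  | nil => simp [windowCount]
  | cons y w ih =>
    simp only [List.map_cons, windowCount, defects, List.count_cons, beq_iff_eq]
    by_cases h : windowClass a (y.1 :: w.map Prod.fst) = some j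
    · by_cases hj : y.2 = j
      · simp only [h, hj, if_true]; omega
      · simp only [h, hj, if_true, Option.some.injEq, Ne.symm hj, if_false]; omega
    · simp only [h, if_false]; split_ifs <;> omega

theorem count_le_windowCount_add (a : X) (j : Fin 4) (w : List (X × Fin 4)) :
    (w.map Prod.snd).count j ≤ windowCount a j (w.map Prod.fst) + defects a w := by
  induction w with
  | nil => simp
  | cons y w ih =>
    simp only [List.map_cons, windowCount, defects, List.count_cons, beq_iff_eq]
    by_cases h : windowClass a (y.1 :: w.map Prod.fst) = some j
    · simp only [h, if_true]; split_ifs <;> omega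
    · by_cases hj : y.2 = j
      · simp only [h, hj, if_true, if_false]; omega
      · simp only [h, hj, if_false]; omega

/-- The letters of `a^ω`, `b^ω`, `(ab)^ω`, `(aabb)^ω`. -/
def blockLetter (a b : X) (j : Fin 4) (i : ℕ) : X :=
  match j with
  | 0 => a
  | 1 => b
  | 2 => if i % 2 = 0 then a else b
  | 3 => if i % 4 < 2 then a else b

theorem windowClass_blockLetter {a b : X} (hab : a ≠ b) (j : Fin 4) (i : ℕ) (l : List X) :
    windowClass a (blockLetter a b j i :: blockLetter a b j (i + 1) ::
      blockLetter a b j (i + 2) :: l) = some j := by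
  fin_cases j
  · simp [windowClass, blockLetter]
  · simp [windowClass, blockLetter, hab.symm]
  · rcases Nat.mod_two_eq_zero_or_one i with h | h <;>
      simp [windowClass, blockLetter, Nat.add_mod, h, hab, hab.symm]
  · have h : i % 4 < 4 := Nat.mod_lt _ (by norm_num)
    interval_cases h' : i % 4 <;>
      simp [windowClass, blockLetter, Nat.add_mod, h', hab, hab.symm]

/-- A factor of `a^ω`, `b^ω`, `(ab)^ω`, `(aabb)^ω`, respectively, with letters tagged by `j`. -/
def block (a b : X) (j : Fin 4) (s n : ℕ) : List (X × Fin 4) :=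
  (List.range' s n).map fun i => (blockLetter a b j i, j)

theorem map_snd_block (a b : X) (j : Fin 4) (s n : ℕ) :
    (block a b j s n).map Prod.snd = List.replicate n j := by
  simp [block, Function.comp_def]

theorem defects_block_le {a b : X} (hab : a ≠ b) (j : Fin 4) (s n : ℕ) :
    defects a (block a b j s n) ≤ 2 := by
  match n with
  | 0 => simp [block, defects]
  | 1 =>
    simp only [block, List.range'_succ, List.range'_zero, List.map_cons, List.map_nil, defects]
    split_ifs <;> omega
  | 2 =>
    simp only [block, List.range'_succ, List.range'_zero, List.map_cons, List.map_nil, defects]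
    split_ifs <;> omega
  | n + 3 =>
    have ih := defects_block_le hab j (s + 1) (n + 2)
    have h := windowClass_blockLetter hab j s
      ((block a b j (s + 3) n).map Prod.fst)
    simp only [block, List.range'_succ, List.map_cons] at ih h ⊢
    rw [defects]
    simp only [List.map_cons, h, if_true]
    omega

/-- After deletion of two factors, the tags are still almost determined by the letters. -/
theorem defects_delete_le (a : X) (r s t s' q : List (X × Fin 4)) :
    defects a (r ++ t ++ q) ≤ defects a (r ++ (s ++ t ++ s') ++ q) + 8 := by
  -- Joins create no defects; each of the four cuts costs at most 2.
  have h₁ := defects_append_le a (r ++ t) q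
  have h₂ := defects_append_le a r t
  have h₃ := le_defects_append a (r ++ (s ++ t ++ s')) q
  have h₄ := le_defects_append a r (s ++ t ++ s')
  have h₅ := le_defects_append a (s ++ t) s'
  have h₆ := le_defects_append a s t
  omega

/-- Tag counts are compared through window counts, which nearly agree for cyclic shifts. Only the
letters have to be related by `κ`; the tags do not. -/
theorem count_le_of_cyclicRel (a : X) (j : Fin 4) {v w : List (X × Fin 4)}
    (h : (v.map Prod.fst, w.map Prod.fst) ∈ cyclicRel X) :
    (v.map Prod.snd).count j ≤ (w.map Prod.snd).count j + defects a v + defects a w + 2 ∧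
    (w.map Prod.snd).count j ≤ (v.map Prod.snd).count j + defects a v + defects a w + 2 := by
  obtain ⟨p, q, h⟩ := h
  obtain ⟨hv, hw⟩ := Prod.mk.inj h
  have h₁ := count_le_windowCount_add a j v
  have h₂ := count_le_windowCount_add a j w
  have h₃ := windowCount_le_count_add a j v
  have h₄ := windowCount_le_count_add a j w
  have h₅ := windowCount_append_comm_le a j p q
  have h₆ := windowCount_append_comm_le a j q p
  rw [hv] at h₁ h₃
  rw [hw] at h₂ h₄
  omega

end Windows

/-! ### The cyclic permutation relation is not the projection of a context-free language -/

section NotContextFree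

variable {X : Type*}

/-! ### Tagged letters on the two tapes -/

theorem tapeProj_append {A : Type*} (v w : List (Option A × Option A)) :
    tapeProj (v ++ w) = ((tapeProj v).1 ++ (tapeProj w).1, (tapeProj v).2 ++ (tapeProj w).2) := by
  simp [tapeProj]

/-- Forget the tags of the letters on both tapes. -/
def untag : Option (X × Fin 4) × Option (X × Fin 4) → Option X × Option X :=
  Prod.map (Option.map Prod.fst) (Option.map Prod.fst)

theorem tapeProj_map_untag (w : List (Option (X × Fin 4) × Option (X × Fin 4))) :
    tapeProj (w.map untag) = ((tapeProj w).1.map Prod.fst, (tapeProj w).2.map Prod.fst) := by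
  induction w with
  | nil => rfl
  | cons y w ih =>
    obtain ⟨_ | y₁, _ | y₂⟩ := y <;> simpa [tapeProj, untag] using ih

theorem filterMap_cons_eq {A B : Type*} (f : A → Option B) (y : A) (l : List A) :
    (y :: l).filterMap f = (f y).toList ++ l.filterMap f := by
  rw [List.filterMap_cons]
  cases f y <;> rfl

/-- Every letter of a tape comes from exactly one position of `z`, so tags on the tapes lift to `z`.
This lets the tags survive pumping in a grammar that does not see them. -/
theorem exists_map_untag_eq (z : List (Option X × Option X)) (v w : List (X × Fin 4))
    (h : tapeProj z = (v.map Prod.fst, w.map Prod.fst)) :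
    ∃ z', z'.map untag = z ∧ tapeProj z' = (v, w) := by
  induction z generalizing v w with
  | nil =>
    simp only [tapeProj, List.filterMap_nil, Prod.mk.injEq] at h
    obtain rfl := List.map_eq_nil_iff.1 h.1.symm
    obtain rfl := List.map_eq_nil_iff.1 h.2.symm
    exact ⟨[], rfl, rfl⟩
  | cons y z ih =>
    obtain ⟨y₁, y₂⟩ := y
    have key : ∀ (o : Option X) (l : List X) (v : List (X × Fin 4)),
        (o.toList ++ l = v.map Prod.fst) → ∃ (o' : Option (X × Fin 4)) (v' : List (X × Fin 4)),
          o'.map Prod.fst = o ∧ l = v'.map Prod.fst ∧ v = o'.toList ++ v' := by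
      intro o l v h
      cases o with
      | none => exact ⟨none, v, rfl, h, rfl⟩
      | some o =>
        cases v with
        | nil => simp at h
        | cons c v =>
          simp only [Option.toList_some, List.cons_append, List.nil_append, List.map_cons,
            List.cons.injEq] at h
          exact ⟨some c, v, by simp [h.1], h.2, rfl⟩
    simp only [tapeProj, filterMap_cons_eq, Prod.mk.injEq] at h
    obtain ⟨o₁, v', ho₁, hv', rfl⟩ := key _ _ _ h.1
    obtain ⟨o₂, w', ho₂, hw', rfl⟩ := key _ _ _ h.2
    obtain ⟨z', rfl, hz'⟩ := ih v' w' (Prod.ext hv' hw')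
    refine ⟨(o₁, o₂) :: z', by simp [untag, ho₁, ho₂], ?_⟩
    simp only [tapeProj, Prod.mk.injEq] at hz'
    simp only [tapeProj, filterMap_cons_eq, hz'.1, hz'.2]

/-- The tags of the letters of a word that are `i` or `j`. -/
def tagsIn (i j : Fin 4) (w : List (X × Fin 4)) : List (Fin 4) :=
  (w.map Prod.snd).filter fun t => t = i ∨ t = j

theorem tagsIn_append (i j : Fin 4) (v w : List (X × Fin 4)) :
    tagsIn i j (v ++ w) = tagsIn i j v ++ tagsIn i j w := by
  simp [tagsIn]

theorem mem_tagsIn {i j t : Fin 4} {w : List (X × Fin 4)} :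
    t ∈ tagsIn i j w ↔ t ∈ w.map Prod.snd ∧ (t = i ∨ t = j) := by
  simp [tagsIn]

theorem length_tagsIn {i j : Fin 4} (hij : i ≠ j) (w : List (X × Fin 4)) :
    (tagsIn i j w).length = (w.map Prod.snd).count i + (w.map Prod.snd).count j := by
  induction w with
  | nil => rfl
  | cons y w ih =>
    simp only [tagsIn, List.map_cons, List.filter_cons, List.count_cons, beq_iff_eq] at ih ⊢
    by_cases hi : y.2 = i
    · have hj : y.2 ≠ j := fun h => hij (hi.symm.trans h)
      rw [if_pos (by simp [hi]), if_pos hi, if_neg hj, List.length_cons, ih]; omega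
    · by_cases hj : y.2 = j
      · rw [if_pos (by simp [hj]), if_pos hj, if_neg hi, List.length_cons, ih]; omega
      · rw [if_neg (by simp [hi, hj]), if_neg hi, if_neg hj, ih]; omega

theorem tagsIn_block (a b : X) (i j k : Fin 4) (s n : ℕ) :
    tagsIn i j (block a b k s n) = if k = i ∨ k = j then List.replicate n k else [] := by
  rw [tagsIn, map_snd_block, List.filter_replicate]
  simp

/-- The number of letters with tag `i` or `j` on both tapes. -/
def tagWeight (i j : Fin 4) (y : Option (X × Fin 4) × Option (X × Fin 4)) : ℕ :=
  (tagsIn i j (tapeProj [y]).1).length + (tagsIn i j (tapeProj [y]).2).length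

theorem tagWeight_le (i j : Fin 4) (y : Option (X × Fin 4) × Option (X × Fin 4)) :
    tagWeight i j y ≤ 2 := by
  have h : ∀ o : Option (X × Fin 4), (tagsIn i j ([o].filterMap id)).length ≤ 1 := by
    intro o
    refine (List.length_filter_le _ _).trans ?_
    cases o <;> simp
  obtain ⟨y₁, y₂⟩ := y
  have h₁ := h y₁
  have h₂ := h y₂
  have e₁ : [y₁].filterMap id = (tapeProj [(y₁, y₂)]).1 := by cases y₁ <;> rfl
  have e₂ : [y₂].filterMap id = (tapeProj [(y₁, y₂)]).2 := by cases y₂ <;> rfl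
  rw [e₁] at h₁
  rw [e₂] at h₂
  simp only [tagWeight]
  omega

theorem weight_tagWeight (i j : Fin 4) (w : List (Option (X × Fin 4) × Option (X × Fin 4))) :
    weight (tagWeight i j) w =
      (tagsIn i j (tapeProj w).1).length + (tagsIn i j (tapeProj w).2).length := by
  induction w with
  | nil => rfl
  | cons y w ih =>
    have h := tapeProj_append [y] w
    rw [List.singleton_append] at h
    simp only [weight, List.map_cons, List.sum_cons] at ih ⊢
    rw [ih, h, tagWeight]
    simp only [tagsIn_append, List.length_append]
    omega

/-- If one map to words over `{i, j}` sends the two parts of a word to `i^n j^n` and `ε`, and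
another one sends them to `ε` and `i^n j^n`, then no letter occurs in both images of a factor with
short images. -/
theorem disjoint_of_sequential {Y A : Type*} {i j : A} (hij : i ≠ j) {n : ℕ} {F G : List Y → List A}
    (hF : ∀ v w, F (v ++ w) = F v ++ F w) (hG : ∀ v w, G (v ++ w) = G v ++ G w)
    {z₁ z₂ r t q : List Y} (hz : z₁ ++ z₂ = r ++ t ++ q)
    (hF₁ : F z₁ = List.replicate n i ++ List.replicate n j) (hF₂ : F z₂ = [])
    (hG₁ : G z₁ = []) (hG₂ : G z₂ = List.replicate n i ++ List.replicate n j)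
    (ht : (F t).length + (G t).length ≤ n) (k : A) : k ∉ F t ∨ k ∉ G t := by
  rcases List.append_eq_append_iff.1 hz with ⟨c, h₁, h₂⟩ | ⟨c, rfl, rfl⟩
  · subst h₂
    simp only [hF, List.append_eq_nil_iff] at hF₂
    rcases List.append_eq_append_iff.1 h₁ with ⟨d, rfl, rfl⟩ | ⟨d, rfl, rfl⟩
    · rw [hF] at hF₁
      simp only [hG, List.append_eq_nil_iff] at hG₁ hG₂
      simp only [hF, hG, hF₂.1, hG₁.2, List.append_nil, List.nil_append] at ht ⊢
      -- The factor straddles the cut as `t = d ++ c`. Being short, its `F`-image stays within the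
      -- final `j`-block and its `G`-image within the initial `i`-block.
      have hd : F d <:+ List.replicate n j :=
        List.suffix_of_suffix_length_le ⟨_, hF₁⟩ ⟨_, rfl⟩ (by rw [List.length_replicate]; omega)
      have hc : G c <+: List.replicate n i :=
        List.prefix_of_prefix_length_le ⟨_, hG₂⟩ ⟨_, rfl⟩ (by rw [List.length_replicate]; omega)
      by_contra! h
      exact hij ((List.eq_of_mem_replicate (hc.subset h.2)).symm.trans
        (List.eq_of_mem_replicate (hd.subset h.1)))
    · left
      simp only [hF, List.append_eq_nil_iff] at hF₂
      simp [hF₂]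
  · right
    simp only [hG, List.append_eq_nil_iff] at hG₁
    simp [hG₁]

theorem count_blocks (a b : X) (n : ℕ) (k : Fin 4) :
    ((((block a b 0 0 n ++ block a b 1 0 n) ++ (block a b 2 0 n ++ block a b 3 0 n))).map
      Prod.snd).count k = n := by
  simp only [List.map_append, map_snd_block, List.count_append, List.count_replicate]
  fin_cases k <;> simp

theorem exists_sequential_tags (a b : X) (n : ℕ)
    (z : List (Option (X × Fin 4) × Option (X × Fin 4)))
    (hz : tapeProj z =
      ((block a b 0 0 n ++ block a b 1 0 n) ++ (block a b 2 0 n ++ block a b 3 0 n),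
      (block a b 2 0 n ++ block a b 3 0 n) ++ (block a b 0 0 n ++ block a b 1 0 n))) :
    ∃ i j, i ≠ j ∧ ∀ r t q, z = r ++ t ++ q → weight (tagWeight i j) t ≤ n →
      ∀ k, k ∉ tagsIn i j (tapeProj t).1 ∨ k ∉ tagsIn i j (tapeProj t).2 := by
  have happ₁ : ∀ (i j : Fin 4) (v w : List (Option (X × Fin 4) × Option (X × Fin 4))),
      tagsIn i j (tapeProj (v ++ w)).1 =
        tagsIn i j (tapeProj v).1 ++ tagsIn i j (tapeProj w).1 := by
    intro i j v w
    rw [tapeProj_append, tagsIn_append]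
  have happ₂ : ∀ (i j : Fin 4) (v w : List (Option (X × Fin 4) × Option (X × Fin 4))),
      tagsIn i j (tapeProj (v ++ w)).2 =
        tagsIn i j (tapeProj v).2 ++ tagsIn i j (tapeProj w).2 := by
    intro i j v w
    rw [tapeProj_append, tagsIn_append]
  obtain ⟨h₁, h₂⟩ := Prod.mk.inj hz
  obtain ⟨z₁, z₂, rfl, hu, hv⟩ := List.filterMap_eq_append_iff.1 h₁
  rw [List.filterMap_append] at h₂
  replace hu : (tapeProj z₁).1 = _ := hu
  replace hv : (tapeProj z₂).1 = _ := hv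
  -- Tape 1 passes from `u` to `v` between `z₁` and `z₂`. The cases are whether tape 2 is then still
  -- within `v` or has already finished it.
  rcases List.append_eq_append_iff.1 h₂ with ⟨c, hc₁, hc₂⟩ | ⟨c, hc₁, hc₂⟩
  · -- the tape `1` occurrence of the blocks `0` and `1` precedes the one on tape `2`
    replace hc₂ : (tapeProj z₂).2 = _ := hc₂
    have h01 := congrArg (tagsIn 0 1) hc₁
    simp [tagsIn_append, tagsIn_block] at h01
    refine ⟨0, 1, by decide, fun r t q h ht => disjoint_of_sequential (n := n)
      (F := fun w => tagsIn 0 1 (tapeProj w).1) (G := fun w => tagsIn 0 1 (tapeProj w).2)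
      (show (0 : Fin 4) ≠ 1 by decide) (happ₁ 0 1) (happ₂ 0 1) h ?_ ?_ ?_ ?_ ?_⟩
    · simp [hu, tagsIn_append, tagsIn_block]
    · simp [hv, tagsIn_append, tagsIn_block]
    · exact h01.1
    · simp [hc₂, tagsIn_append, tagsIn_block, h01.2]
    · rwa [weight_tagWeight] at ht
  · -- the tape `2` occurrence of the blocks `2` and `3` precedes the one on tape `1`
    replace hc₁ : (tapeProj z₁).2 = _ := hc₁
    have h23 := congrArg (tagsIn 2 3) hc₂
    simp [tagsIn_append, tagsIn_block] at h23
    refine ⟨2, 3, by decide, fun r t q h ht k => (disjoint_of_sequential (n := n)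
      (F := fun w => tagsIn 2 3 (tapeProj w).2) (G := fun w => tagsIn 2 3 (tapeProj w).1)
      (show (2 : Fin 4) ≠ 3 by decide) (happ₂ 2 3) (happ₁ 2 3) h ?_ ?_ ?_ ?_ ?_ k).symm⟩
    · simp [hc₁, tagsIn_append, tagsIn_block, h23.1]
    · exact h23.2
    · simp [hu, tagsIn_append, tagsIn_block]
    · simp [hv, tagsIn_append, tagsIn_block]
    · rwa [weight_tagWeight, add_comm] at ht

theorem cyclicRel_notMem_T_CF {a b : X} (hab : a ≠ b) : cyclicRel X ∉ T CF X := by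
  rintro ⟨L, ⟨g, rfl⟩, hκ⟩
  -- A position carries at most one letter per tape, hence weight at most 2. The value 69 exceeds
  -- twice the bound 34 obtained below for a single tag.
  obtain ⟨p, hp⟩ := exists_pumps (Y := Option (X × Fin 4) × Option (X × Fin 4)) g 2 69
  set u := block a b 0 0 (p + 1) ++ block a b 1 0 (p + 1) with hu
  set v := block a b 2 0 (p + 1) ++ block a b 3 0 (p + 1) with hv
  have hmem : ((u ++ v).map Prod.fst, (v ++ u).map Prod.fst) ∈ cyclicRel X :=
    ⟨u.map Prod.fst, v.map Prod.fst, by simp only [List.map_append]⟩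
  rw [hκ] at hmem
  obtain ⟨_, hzL, hzuv⟩ := hmem
  obtain ⟨z, rfl, hz⟩ := exists_map_untag_eq _ _ _ hzuv
  obtain ⟨i, j, hij, hseq⟩ := exists_sequential_tags a b (p + 1) z hz
  have hcount₁ : ∀ k, (((tapeProj z).1).map Prod.snd).count k = p + 1 := fun k => by
    rw [hz]
    exact count_blocks a b (p + 1) k
  have hcount₂ : ∀ k, (((tapeProj z).2).map Prod.snd).count k = p + 1 := fun k => by
    have h := count_blocks a b (p + 1) k
    rw [hz]
    simp only [List.map_append, List.count_append, hu, hv] at h ⊢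
    omega
  obtain ⟨r, s, t, s', q, hfac, hgen, hD, hwin⟩ := hp untag (tagWeight i j) (tagWeight_le i j) z hzL
    (by rw [weight_tagWeight, length_tagsIn hij, length_tagsIn hij, hcount₁, hcount₁, hcount₂,
          hcount₂]; omega)
  have hrel : tapeProj ((r ++ t ++ q).map untag) ∈ cyclicRel X := by
    rw [hκ]
    exact ⟨_, hgen.derives, rfl⟩
  rw [tapeProj_map_untag] at hrel
  have hblock := defects_block_le hab
  have hdu : defects a u ≤ 4 := by
    rw [hu]
    have := defects_append_le a (block a b 0 0 (p + 1)) (block a b 1 0 (p + 1))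
    have := hblock 0 0 (p + 1)
    have := hblock 1 0 (p + 1)
    omega
  have hdv : defects a v ≤ 4 := by
    rw [hv]
    have := defects_append_le a (block a b 2 0 (p + 1)) (block a b 3 0 (p + 1))
    have := hblock 2 0 (p + 1)
    have := hblock 3 0 (p + 1)
    omega
  have hd₁ : defects a (tapeProj z).1 ≤ 8 := by
    rw [hz]
    have := defects_append_le a u v
    simp only
    omega
  have hd₂ : defects a (tapeProj z).2 ≤ 8 := by
    rw [hz]
    have := defects_append_le a v u
    simp only
    omega
  have hdel₁ := defects_delete_le a (tapeProj r).1 (tapeProj s).1 (tapeProj t).1 (tapeProj s').1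
    (tapeProj q).1
  have hdel₂ := defects_delete_le a (tapeProj r).2 (tapeProj s).2 (tapeProj t).2 (tapeProj s').2
    (tapeProj q).2
  -- After the deletion each tape has at most `8 + 8` defects, so the counts of `k` differ by at
  -- most `16 + 16 + 2 = 34`. They agreed before, and the deletion affects `k` on one tape only, so
  -- this bounds the number of deleted letters.
  have hk : ∀ k, k = i ∨ k = j →
      ((tapeProj s).1.map Prod.snd).count k + ((tapeProj s').1.map Prod.snd).count k +
      (((tapeProj s).2.map Prod.snd).count k + ((tapeProj s').2.map Prod.snd).count k) ≤ 34 := by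
    intro k hkij
    obtain ⟨hle, hge⟩ := count_le_of_cyclicRel a k hrel
    have hc₁ := hcount₁ k
    have hc₂ := hcount₂ k
    have hdisj := hseq r _ q hfac (hwin.trans p.le_succ) k
    rw [hfac] at hc₁ hc₂ hd₁ hd₂
    simp only [tapeProj_append, List.map_append, List.count_append, mem_tagsIn, hkij, and_true]
      at hle hge hc₁ hc₂ hd₁ hd₂ hdel₁ hdel₂ hdisj
    rw [← List.count_pos_iff, ← List.count_pos_iff] at hdisj
    simp only [List.count_append] at hdisj
    omega
  have hi := hk i (.inl rfl)
  have hj := hk j (.inr rfl)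
  rw [weight_tagWeight, weight_tagWeight] at hD
  simp only [length_tagsIn hij] at hD
  omega

end NotContextFree
-- The words of the unfolded cyclic permutation relation
theorem mem_unfolded_cyclicRel {X : Type*} {w : List (Option X)} :
    w ∈ unfolded (cyclicRel X) ↔ ∃ u v : List X, w = u.map some ++ v.map some ++ [none] ++
      u.reverse.map some ++ v.reverse.map some := by
  constructor
  · rintro ⟨_, _, ⟨u, v, h⟩, rfl⟩
    obtain ⟨rfl, rfl⟩ := Prod.mk.inj h
    exact ⟨u, v, by simp⟩
  · rintro ⟨u, v, rfl⟩
    exact ⟨u ++ v, v ++ u, ⟨u, v, rfl⟩, by simp⟩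

/-! ### An ET0L-system for the unfolded cyclic permutation relation -/

section ET0L

variable {X : Type*}

/-- The substitutions of the ET0L-system: `some (false, x)` adds `x` to `u` in `u v # u^rev v^rev`,
and `some (true, x)` adds `x` to `v`, while `none` erases the nonterminals. -/
def cyclicSubst : Option (Bool × X) → Symbol (Option X) (Fin 4) → List (Symbol (Option X) (Fin 4))
  | _, .terminal s => [.terminal s]
  | none, .nonterminal _ => []
  | some (false, x), .nonterminal 0 => [.terminal (some x), .nonterminal 0]
  | some (false, x), .nonterminal 2 => [.nonterminal 2, .terminal (some x)]
  | some (true, x), .nonterminal 1 => [.terminal (some x), .nonterminal 1]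
  | some (true, x), .nonterminal 3 => [.nonterminal 3, .terminal (some x)]
  | some _, .nonterminal i => [.nonterminal i]

/-- The table that applies a substitution. -/
def substTable (c : Option (Bool × X)) :
    Set (Symbol (Option X) (Fin 4) × List (Symbol (Option X) (Fin 4))) :=
  Set.range fun s => (s, cyclicSubst c s)

theorem mem_substTable {c : Option (Bool × X)} {s : Symbol (Option X) (Fin 4)}
    {w : List (Symbol (Option X) (Fin 4))} : (s, w) ∈ substTable c ↔ w = cyclicSubst c s := by
  simp [substTable, eq_comm]

instance finite_symbol {S N : Type*} [Finite S] [Finite N] : Finite (Symbol S N) :=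
  Finite.of_surjective (fun s : S ⊕ N => s.elim Symbol.terminal Symbol.nonterminal) fun s => by
    cases s with
    | terminal s => exact ⟨.inl s, rfl⟩
    | nonterminal s => exact ⟨.inr s, rfl⟩

/-- The sentential form `u A v B # C u^rev D v^rev`. -/
def cyclicForm (u v : List X) : List (Symbol (Option X) (Fin 4)) :=
  (u.map some).map .terminal ++ [.nonterminal 0] ++ (v.map some).map .terminal ++
    [.nonterminal 1, .terminal none, .nonterminal 2] ++ (u.reverse.map some).map .terminal ++
    [.nonterminal 3] ++ (v.reverse.map some).map .terminal

/-- An ET0L-system for the language of the words `u v # u^rev v^rev`. -/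
def cyclicET0L (X : Type*) [Finite X] : ET0LSystem (Option X) where
  NT := Fin 4
  tables := Set.range substTable
  start := cyclicForm [] []
  finite_NT := inferInstance
  tables_finite := Set.finite_range _
  tables_nonempty := Set.range_nonempty _
  table_finite := by
    rintro _ ⟨c, rfl⟩
    exact Set.finite_range _
  table_complete := by
    rintro _ ⟨c, rfl⟩ s
    exact ⟨_, s, rfl⟩
  start_ne_nil := by simp [cyclicForm]

/-- Each table is the graph of a function, so a step is the application of a homomorphism. -/
theorem cyclicET0L_step_iff [Finite X] {v w : List (Symbol (Option X) (Fin 4))} :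
    (cyclicET0L X).Step v w ↔ ∃ c, w = v.flatMap (cyclicSubst c) := by
  have key : ∀ (c : Option (Bool × X)) (v : List (Symbol (Option X) (Fin 4))) ws,
      List.Forall₂ (fun s w => (s, w) ∈ substTable c) v ws ↔ ws = v.map (cyclicSubst c) := by
    intro c v ws
    induction v generalizing ws with
    | nil => simp
    | cons s v ih =>
      simp only [mem_substTable] at ih ⊢
      simp only [List.forall₂_cons_left_iff, List.map_cons, ih]
      constructor
      · rintro ⟨_, _, rfl, rfl, rfl⟩
        rfl
      · rintro rfl
        exact ⟨_, _, rfl, rfl, rfl⟩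
  constructor
  · rintro ⟨_, ⟨c, rfl⟩, ws, h, rfl⟩
    obtain rfl := (key c v ws).1 h
    exact ⟨c, List.flatMap_def.symm⟩
  · rintro ⟨c, rfl⟩
    exact ⟨_, ⟨c, rfl⟩, _, (key c v _).2 rfl, List.flatMap_def⟩

theorem flatMap_cyclicSubst_terminal (c : Option (Bool × X)) (w : List (Option X)) :
    (w.map Symbol.terminal).flatMap (cyclicSubst c) = w.map Symbol.terminal := by
  induction w with
  | nil => rfl
  | cons s w ih => simpa [cyclicSubst] using ih

theorem cyclicForm_flatMap (u v : List X) (c : Option (Bool × X)) :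
    (cyclicForm u v).flatMap (cyclicSubst c) = match c with
      | none => (u.map some ++ v.map some ++ [none] ++ u.reverse.map some ++
          v.reverse.map some).map .terminal
      | some (false, x) => cyclicForm (u ++ [x]) v
      | some (true, x) => cyclicForm u (v ++ [x]) := by
  rw [cyclicForm]
  simp only [List.flatMap_append, flatMap_cyclicSubst_terminal]
  match c with
  | none => simp [cyclicSubst]
  | some (false, x) => simp [cyclicSubst, cyclicForm]
  | some (true, x) => simp [cyclicSubst, cyclicForm]

theorem cyclicET0L_language (X : Type*) [Finite X] :
    (cyclicET0L X).language = unfolded (cyclicRel X) := by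
  ext w
  rw [mem_unfolded_cyclicRel]
  constructor
  · intro h
    have key : ∀ a, Relation.ReflTransGen (cyclicET0L X).Step (cyclicForm [] []) a →
        ∃ u v : List X, a = cyclicForm u v ∨ a = (u.map some ++ v.map some ++ [none] ++
          u.reverse.map some ++ v.reverse.map some).map .terminal := by
      intro a ha
      induction ha with
      | refl => exact ⟨[], [], .inl rfl⟩
      | tail _ hstep ih =>
        obtain ⟨c, rfl⟩ := cyclicET0L_step_iff.1 hstep
        obtain ⟨u, v, rfl | rfl⟩ := ih
        · rw [cyclicForm_flatMap]
          match c with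
          | none => exact ⟨u, v, .inr rfl⟩
          | some (false, x) => exact ⟨_, _, .inl rfl⟩
          | some (true, x) => exact ⟨_, _, .inl rfl⟩
        -- Every table fixes the terminals, so a terminal word never changes again.
        · exact ⟨u, v, .inr (flatMap_cyclicSubst_terminal c _)⟩
    obtain ⟨u, v, h | h⟩ := key _ h
    · have h0 : Symbol.nonterminal 0 ∈ cyclicForm u v := by simp [cyclicForm]
      replace h : w.map Symbol.terminal = cyclicForm u v := h
      rw [← h] at h0
      simp at h0
    · exact ⟨u, v, List.map_injective_iff.2 (fun _ _ => Symbol.terminal.inj) h⟩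
  · rintro ⟨u, v, rfl⟩
    have hstep : ∀ (u v : List X) c b, (cyclicForm u v).flatMap (cyclicSubst c) = b →
        (cyclicET0L X).Step (cyclicForm u v) b :=
      fun u v c b h => cyclicET0L_step_iff.2 ⟨c, h.symm⟩
    have hu : Relation.ReflTransGen (cyclicET0L X).Step (cyclicForm [] []) (cyclicForm u []) := by
      induction u using List.reverseRecOn with
      | nil => exact .refl
      | append_singleton u x ih =>
        exact ih.tail (hstep u [] (some (false, x)) _ (cyclicForm_flatMap _ _ _))
    have huv : Relation.ReflTransGen (cyclicET0L X).Step (cyclicForm [] []) (cyclicForm u v) := by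
      induction v using List.reverseRecOn with
      | nil => exact hu
      | append_singleton v x ih =>
        exact ih.tail (hstep u v (some (true, x)) _ (cyclicForm_flatMap _ _ _))
    exact huv.tail (hstep u v none _ (cyclicForm_flatMap _ _ _))

end ET0L

/-! ### A linear indexed grammar for the unfolded cyclic permutation relation -/

section LIN

variable {X : Type*}

/-- A sentential form with exactly one nonterminal. -/
def spine {S N : Type*} (l : List S) (A : N) (r : List S) : List (Symbol S N) :=
  l.map .terminal ++ [.nonterminal A] ++ r.map .terminal

theorem spine_eq_append_iff {S N : Type*} {l r : List S} {A B : N} {p q : List (Symbol S N)} :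
    spine l A r = p ++ [.nonterminal B] ++ q ↔
      p = l.map .terminal ∧ B = A ∧ q = r.map .terminal := by
  constructor
  · intro h
    simp only [spine, List.append_assoc, List.singleton_append] at h
    induction l generalizing p with
    | nil =>
      cases p with
      | nil => simpa [eq_comm] using h
      | cons s p =>
        simp only [List.map_nil, List.nil_append, List.cons_append, List.cons.injEq] at h
        have hB : Symbol.nonterminal B ∈ r.map (Symbol.terminal (N := N)) := by
          rw [h.2]
          simp
        simp at hB
    | cons s l ih =>
      cases p with
      | nil => simp at h
      | cons s' p =>
        simp only [List.map_cons, List.cons_append, List.cons.injEq] at h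
        obtain ⟨rfl, h'⟩ := ih h.2
        simp [h.1, h']
  · rintro ⟨rfl, rfl, rfl⟩
    rfl

/-- The productions `A[··] → x A[x··]`, `B[··] → x B[··] x`, `C[x··] → x C[··]`, and
`A[··] → B[··]`, `B[··] → # C[··]`, `C[] → ε`. -/
noncomputable def cyclicRule [Finite X] :
    Fin 3 × Option X → LIRule (Option X) (Fin 3) (Fin (Nat.card X))
  | (0, some x) => .pass 0 [] [.terminal (some x)] 0 [Finite.equivFin X x] []
  | (1, some x) => .pass 1 [] [.terminal (some x)] 1 [] [.terminal (some x)]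
  | (2, some x) => .pass 2 [Finite.equivFin X x] [.terminal (some x)] 2 [] []
  | (0, none) => .pass 0 [] [] 1 [] []
  | (1, none) => .pass 1 [] [.terminal none] 2 [] []
  | (2, none) => .term 2 [] []

/-- A linear indexed grammar for the language of the words `u v # u^rev v^rev`. -/
noncomputable def cyclicLIN (X : Type*) [Finite X] : LinearIndexedGrammar (Option X) where
  NT := Fin 3
  -- The letters are numbered because flags have to live in `Type`, while `X` may lie in a higher
  -- universe.
  Flag := Fin (Nat.card X)
  initial := 0
  rules := Set.range cyclicRule
  finite_NT := inferInstance
  finite_Flag := inferInstance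
  rules_finite := Set.finite_range _

/-- The derivation steps of `cyclicLIN X`. -/
def CyclicStep [Finite X] (a b : List (Symbol (Option X) (Fin 3 × List (Fin (Nat.card X))))) :
    Prop :=
  ∃ c A σ γ p q, (cyclicRule c).Expands A σ γ ∧
    a = p ++ [Symbol.nonterminal (A, σ)] ++ q ∧ b = p ++ γ ++ q

theorem cyclicLIN_step_eq [Finite X] : (cyclicLIN X).Step = CyclicStep (X := X) := by
  ext a b
  constructor
  · rintro ⟨_, ⟨c, rfl⟩, h⟩
    exact ⟨c, h⟩
  · rintro ⟨c, h⟩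
    exact ⟨_, ⟨c, rfl⟩, h⟩

/-- The sentential forms of `cyclicLIN X`. -/
inductive CyclicSentential [Finite X] :
    List (Symbol (Option X) (Fin 3 × List (Fin (Nat.card X)))) → Prop
  | first (u : List X) :
      CyclicSentential (spine (u.map some) (0, u.reverse.map (Finite.equivFin X)) [])
  | second (u v : List X) :
      CyclicSentential (spine (u.map some ++ v.map some)
        (1, u.reverse.map (Finite.equivFin X)) (v.reverse.map some))
  | third (u v p q : List X) (h : u.reverse = p ++ q) :
      CyclicSentential (spine (u.map some ++ v.map some ++ [none] ++ p.map some)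
        (2, q.map (Finite.equivFin X)) (v.reverse.map some))
  | done (u v : List X) :
      CyclicSentential ((u.map some ++ v.map some ++ [none] ++ u.reverse.map some ++
        v.reverse.map some).map .terminal)

theorem CyclicSentential.step [Finite X]
    {a b : List (Symbol (Option X) (Fin 3 × List (Fin (Nat.card X))))} (ha : CyclicSentential a)
    (h : CyclicStep a b) : CyclicSentential b := by
  obtain ⟨c, A, σ, γ, p, q, hexp, ha', rfl⟩ := h
  cases ha with
  | first u =>
    obtain ⟨rfl, hA, rfl⟩ := spine_eq_append_iff.1 ha'
    match c, hexp with
    | (0, some x), .pass _ _ _ _ _ _ rest =>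
      obtain rfl := (Prod.mk.inj hA).2
      simpa [spine] using CyclicSentential.first (u ++ [x])
    | (0, none), .pass _ _ _ _ _ _ rest =>
      obtain rfl := (Prod.mk.inj hA).2
      simpa [spine] using CyclicSentential.second u []
    | (1, some x), .pass _ _ _ _ _ _ rest => simp at hA
    | (1, none), .pass _ _ _ _ _ _ rest => simp at hA
    | (2, some x), .pass _ _ _ _ _ _ rest => simp at hA
    | (2, none), .term _ _ _ => simp at hA
  | second u v =>
    obtain ⟨rfl, hA, rfl⟩ := spine_eq_append_iff.1 ha'
    match c, hexp with
    | (0, some x), .pass _ _ _ _ _ _ rest => simp at hA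
    | (0, none), .pass _ _ _ _ _ _ rest => simp at hA
    | (1, some x), .pass _ _ _ _ _ _ rest =>
      obtain rfl := (Prod.mk.inj hA).2
      simpa [spine] using CyclicSentential.second u (v ++ [x])
    | (1, none), .pass _ _ _ _ _ _ rest =>
      obtain rfl := (Prod.mk.inj hA).2
      simpa [spine] using CyclicSentential.third u v [] u.reverse rfl
    | (2, some x), .pass _ _ _ _ _ _ rest => simp at hA
    | (2, none), .term _ _ _ => simp at hA
  | third u v r s h =>
    obtain ⟨rfl, hA, rfl⟩ := spine_eq_append_iff.1 ha'
    match c, hexp with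
    | (0, some x), .pass _ _ _ _ _ _ rest => simp at hA
    | (0, none), .pass _ _ _ _ _ _ rest => simp at hA
    | (1, some x), .pass _ _ _ _ _ _ rest => simp at hA
    | (1, none), .pass _ _ _ _ _ _ rest => simp at hA
    | (2, some x), .pass _ _ _ _ _ _ rest =>
      cases s with
      | nil => simp at hA
      | cons y s =>
        simp only [List.map_cons, List.singleton_append, Prod.mk.injEq, List.cons.injEq,
          EmbeddingLike.apply_eq_iff_eq, true_and] at hA
        obtain ⟨rfl, rfl⟩ := hA
        simpa [spine] using CyclicSentential.third u v (r ++ [x]) s (by simpa using h)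
    | (2, none), .term _ _ _ =>
      -- The terminating production needs an empty stack, which forces all of `u^rev` to have been
      -- written.
      obtain rfl : s = [] := by simpa using hA
      rw [List.append_nil] at h
      simpa [h] using CyclicSentential.done u v
  | done u v =>
    have hA : Symbol.nonterminal (A, σ) ∈ p ++ [Symbol.nonterminal (A, σ)] ++ q := by simp
    rw [← ha'] at hA
    simp at hA

theorem cyclicStep_spine [Finite X] (c : Fin 3 × Option X) {A : Fin 3} {σ : List (Fin (Nat.card X))}
    {γ : List (Symbol (Option X) (Fin 3 × List (Fin (Nat.card X))))}
    (h : (cyclicRule c).Expands A σ γ) (l r : List (Option X)) :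
    CyclicStep (spine l (A, σ) r) (l.map .terminal ++ γ ++ r.map .terminal) :=
  ⟨c, A, σ, γ, _, _, h, rfl, rfl⟩

theorem cyclicLIN_language (X : Type*) [Finite X] :
    (cyclicLIN X).language = unfolded (cyclicRel X) := by
  ext w
  rw [mem_unfolded_cyclicRel]
  change Relation.ReflTransGen (cyclicLIN X).Step (spine [] ((0 : Fin 3), []) [])
    (w.map .terminal) ↔ _
  rw [cyclicLIN_step_eq]
  constructor
  · intro h
    have key : ∀ a, Relation.ReflTransGen (CyclicStep (X := X))
        (spine [] (0, []) []) a → CyclicSentential a := by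
      intro a ha
      induction ha with
      | refl => exact .first []
      | tail _ hstep ih => exact ih.step hstep
    have hmem : ∀ (l : List (Option X)) (A : Fin 3 × List (Fin (Nat.card X))) (r : List (Option X)),
        w.map Symbol.terminal ≠ spine l A r := by
      intro l A r h
      have hA : Symbol.nonterminal A ∈ spine l A r := by simp [spine]
      rw [← h] at hA
      simp at hA
    generalize hb : w.map Symbol.terminal = b at h
    replace h := key _ h
    cases h with
    | first => exact absurd hb (hmem _ _ _)
    | second => exact absurd hb (hmem _ _ _)
    | third => exact absurd hb (hmem _ _ _)
    | done u v => exact ⟨u, v, List.map_injective_iff.2 (fun _ _ => Symbol.terminal.inj) hb⟩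
  · rintro ⟨u, v, rfl⟩
    have hu : Relation.ReflTransGen CyclicStep (spine [] (0, []) [])
        (spine (u.map some) (0, u.reverse.map (Finite.equivFin X)) []) := by
      induction u using List.reverseRecOn with
      | nil => exact .refl
      | append_singleton u x ih =>
        refine ih.tail ?_
        simpa [spine] using cyclicStep_spine (0, some x) (.pass _ _ _ _ _ _ _) (u.map some) []
    have hu' : CyclicStep (spine (u.map some) (0, u.reverse.map (Finite.equivFin X)) [])
        (spine (u.map some) (1, u.reverse.map (Finite.equivFin X)) []) := by
      simpa [spine] using cyclicStep_spine (0, none) (.pass _ _ _ _ _ _ _) (u.map some) []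
    have hv : Relation.ReflTransGen CyclicStep
        (spine (u.map some) (1, u.reverse.map (Finite.equivFin X)) [])
        (spine (u.map some ++ v.map some) (1, u.reverse.map (Finite.equivFin X))
          (v.reverse.map some)) := by
      induction v using List.reverseRecOn with
      | nil => simpa using .refl
      | append_singleton v x ih =>
        refine ih.tail ?_
        simpa [spine] using cyclicStep_spine (1, some x) (.pass _ _ _ _ _ _ _)
          (u.map some ++ v.map some) (v.reverse.map some)
    have hv' : CyclicStep (spine (u.map some ++ v.map some)
          (1, u.reverse.map (Finite.equivFin X)) (v.reverse.map some))
        (spine (u.map some ++ v.map some ++ [none]) (2, u.reverse.map (Finite.equivFin X))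
          (v.reverse.map some)) := by
      simpa [spine] using cyclicStep_spine (1, none) (.pass _ _ _ _ _ _ _)
        (u.map some ++ v.map some) (v.reverse.map some)
    have hpop : ∀ (s : List X) (l r : List (Option X)), Relation.ReflTransGen CyclicStep
        (spine l (2, s.map (Finite.equivFin X)) r) (spine (l ++ s.map some) (2, []) r) := by
      intro s
      induction s with
      | nil => intro l r; simpa using .refl
      | cons x s ih =>
        intro l r
        have h := ih (l ++ [some x]) r
        rw [List.append_assoc] at h
        refine .head ?_ h
        simpa [spine] using cyclicStep_spine (2, some x) (.pass _ _ _ _ _ _ _) l r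
    have hend : ∀ l r : List (Option X), CyclicStep (spine l (2, []) r)
        ((l ++ r).map .terminal) := by
      intro l r
      simpa using cyclicStep_spine (2, none) (.term _ _ _) l r
    exact (((hu.tail hu').trans hv).tail hv').trans ((hpop _ _ _).tail (hend _ _))

end LIN

end RelHierarchy

theorem proposition3p4 (X : Type*) [Finite X] :
    RelHierarchy.cyclicRel X ∈ RelHierarchy.U RelHierarchy.ET0L X ∧
    RelHierarchy.cyclicRel X ∈ RelHierarchy.U RelHierarchy.LIN X ∧
    (2 ≤ Nat.card X → RelHierarchy.cyclicRel X ∉ RelHierarchy.T RelHierarchy.CF X) := by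
  refine ⟨⟨_, RelHierarchy.cyclicET0L_language X⟩, ⟨_, RelHierarchy.cyclicLIN_language X⟩,
    fun h => ?_⟩
  obtain ⟨a, b, hab⟩ := (Finite.one_lt_card_iff_nontrivial.1 h).exists_pair_ne
  exact RelHierarchy.cyclicRel_notMem_T_CF hab
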